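/- Let $(W,S)$ be a Coxeter system, of arbitrary (possibly infinite) rank. For $I\subseteq S$ let $W_I$ be the parabolic subgroup generated by $I$, and, when $W_I$ is finite, let $w_0(I)$ be its longest element. Let $H\trianglelefteq W$ be a normal subgroup generated by involutions, and let $X_H$ be the set of all elements of $H$ of the form $w_0(I)$, with $I\subseteq S$ and $W_I$ finite, such that $1\neq w_0(I)\in Z(W_I)$. Then $H$ is the smallest normal subgroup of $W$ containing $X_H$, and $$Z_W(H)=\bigcap_{I\subseteq S,\ w_0(I)\in X_H}\mathrm{Core}_W\bigl(N_W(W_I)\bigr),$$ where $Z_W(H)$ is the centralizer of $H$ in $W$, $N_W(W_I)$ is the normalizer of $W_I$ in $W$, $\mathrm{Core}_W(K)=\bigcap_{w\in W}wKw^{-1}$ is the largest normal subgroup of $W$ contained in $K$, and an empty intersection is $W$. -/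

import Mathlib

namespace CoxeterSystem

variable {B W : Type*} [Group W] {M : CoxeterMatrix B} (cs : CoxeterSystem M W)

/-- The parabolic subgroup `W_I`, generated by the simple reflections with index in `I`. -/
def parabolic (I : Set B) : Subgroup W :=
  Subgroup.closure (cs.simple '' I)

/-- `w = w_0(I)`: the parabolic subgroup `W_I` is finite and `w` is its longest element.
(The length function of `W_I` with respect to `I` is the restriction of that of `W`.) -/
structure IsLongestElement (I : Set B) (w : W) : Prop where
  finite : (cs.parabolic I : Set W).Finite
  mem : w ∈ cs.parabolic I
  length_le : ∀ u ∈ cs.parabolic I, cs.length u ≤ cs.length w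

/-- `w = w_0(I)`, and `1 ≠ w ∈ Z(W_I)`. -/
structure IsCentralLongestElement (I : Set B) (w : W) : Prop where
  isLongestElement : cs.IsLongestElement I w
  ne_one : w ≠ 1
  central : ∀ u ∈ cs.parabolic I, u * w = w * u

/-- The set `X_G` of all elements of the subgroup `G` of the form `w_0(I)`, for some set `I` of
simple reflections with `W_I` finite, such that `1 ≠ w_0(I) ∈ Z(W_I)`. -/
def centralLongestElements (G : Subgroup W) : Set W :=
  {w | w ∈ G ∧ ∃ I : Set B, cs.IsCentralLongestElement I w}

end CoxeterSystem

/-- The subgroup `H` is generated by a set of elements of order two. -/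
def GeneratedByInvolutions {W : Type*} [Group W] (H : Subgroup W) : Prop :=
  ∃ T : Set W, (∀ t ∈ T, orderOf t = 2) ∧ Subgroup.closure T = H

namespace CoxeterSystem

variable {B W : Type*} [Group W] {M : CoxeterMatrix B} (cs : CoxeterSystem M W)

/-! ### The parity cocycle and the inversions of a product -/

/-! Two facts about Coxeter groups carry the proof. By Richardson's theorem, every involution is
conjugate to some `w_0(I)` central in `W_I`; as `H` is normal and generated by involutions, the
conjugates of `X_H` generate it. And if `w_0(I)` is nontrivial and central in `W_I`, then `N_W(W_I)`
is exactly the centralizer of `w_0(I)` (`IsCentralLongestElement.mem_normalizer_iff`). So `z`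
centralizes `H` iff it commutes with every conjugate of every `w_0(I)` in `X_H`, iff all conjugates
of `z` lie in each `N_W(W_I)`, iff `z` lies in all the cores.

Both facts rest on the cocycle rule for inversion sets, `N(xy) = N(x) ∆ x N(y) x⁻¹`
(`isLeftInversion_mul_iff`), obtained from an action of `W` on `W × ZMod 2`. -/

open Classical in
/-- The action of a simple reflection on pairs consisting of a group element and a parity. -/
noncomputable def simpleParityMap (i : B) : Function.End (W × ZMod 2) := fun p ↦
  (cs.simple i * p.1 * cs.simple i, p.2 + if p.1 = cs.simple i then 1 else 0)

open Classical in
theorem simpleParityMap_mul_pow (i j : B) (n : ℕ) (t : W) (e : ZMod 2) :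
    ((cs.simpleParityMap i * cs.simpleParityMap j) ^ n : Function.End (W × ZMod 2)) (t, e) =
      ((cs.simple i * cs.simple j) ^ n * t * ((cs.simple i * cs.simple j) ^ n)⁻¹,
        e + ∑ k ∈ Finset.range (2 * n),
          if t = cs.simple j * (cs.simple i * cs.simple j) ^ k then 1 else 0) := by
  induction n with
  | zero => simp; rfl
  | succ n ih =>
    have hflip (k : ℕ) : cs.simple j * (cs.simple i * cs.simple j) ^ k =
        ((cs.simple i * cs.simple j) ^ k)⁻¹ * cs.simple j := by
      induction k with
      | zero => simp
      | succ k ihk =>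
        rw [pow_succ, ← mul_assoc, ihk, ← pow_succ, pow_succ', mul_inv_rev]
        simp [mul_assoc]
    set c := cs.simple i * cs.simple j with hc
    have h₁ : c ^ n * t * (c ^ n)⁻¹ = cs.simple j ↔ t = cs.simple j * c ^ (2 * n) := by
      rw [two_mul, pow_add, ← mul_assoc, hflip, mul_inv_eq_iff_eq_mul, mul_assoc _ (cs.simple j),
        ← mul_right_inj (c ^ n)⁻¹]
      simp
    have h₂ : cs.simple j * (c ^ n * t * (c ^ n)⁻¹) * cs.simple j = cs.simple i ↔
        t = cs.simple j * c ^ (2 * n + 1) := by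
      have : cs.simple j * c ^ (2 * n + 1) =
          (c ^ n)⁻¹ * (cs.simple j * cs.simple i * cs.simple j) * c ^ n := by
        rw [show 2 * n + 1 = n + 1 + n by ring, pow_add, ← mul_assoc, pow_succ, ← mul_assoc,
          hflip, hc]
        simp [mul_assoc]
      rw [this]
      constructor
      · intro h
        rw [← h]
        simp [mul_assoc]
      · intro h
        rw [h]
        simp [mul_assoc]
    rw [pow_succ']
    change (cs.simpleParityMap i) ((cs.simpleParityMap j) _) = _
    rw [ih]
    simp only [simpleParityMap, h₁, h₂]
    rw [show 2 * (n + 1) = 2 * n + 1 + 1 by ring, Finset.sum_range_succ, Finset.sum_range_succ]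
    refine Prod.ext ?_ ?_
    · simp [pow_succ', mul_assoc, hc]
    · simp only [add_assoc]

theorem isLiftable_simpleParityMap : M.IsLiftable cs.simpleParityMap := by
  classical
  intro i j
  funext ⟨t, e⟩
  rw [simpleParityMap_mul_pow]
  -- The summands have period `M i j`, so the `2 * M i j` terms cancel in pairs modulo 2.
  simp only [two_mul, Finset.sum_range_add, pow_add, simple_mul_simple_pow, one_mul, inv_one,
    mul_one, CharTwo.add_self_eq_zero, add_zero]
  rfl

/-- The extension of `simpleParityMap` to the Coxeter group. -/
noncomputable def parityAction : W →* Function.End (W × ZMod 2) :=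
  cs.lift ⟨cs.simpleParityMap, cs.isLiftable_simpleParityMap⟩

/-- The parity of the number of occurrences of `t` in the right inversion sequence of any word
for `w`. -/
noncomputable def inversionParity (w t : W) : ZMod 2 := (cs.parityAction w (t, 0)).2

theorem parityAction_simple (i : B) : cs.parityAction (cs.simple i) = cs.simpleParityMap i :=
  cs.lift_apply_simple _ i

open Classical in
theorem parityAction_wordProd (ω : List B) (t : W) (e : ZMod 2) :
    cs.parityAction (cs.wordProd ω) (t, e) =
      (cs.wordProd ω * t * (cs.wordProd ω)⁻¹, e + ((cs.rightInvSeq ω).count t : ZMod 2)) := by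
  induction ω with
  | nil => simp; rfl
  | cons i ω ih =>
    rw [wordProd_cons, map_mul]
    change cs.parityAction (cs.simple i) (cs.parityAction (cs.wordProd ω) (t, e)) = _
    rw [ih, parityAction_simple]
    have h : cs.wordProd ω * t * (cs.wordProd ω)⁻¹ = cs.simple i ↔
        (cs.wordProd ω)⁻¹ * cs.simple i * cs.wordProd ω = t := by
      rw [mul_inv_eq_iff_eq_mul, mul_assoc, inv_mul_eq_iff_eq_mul, eq_comm]
    simp only [simpleParityMap, rightInvSeq, List.count_cons, h, beq_iff_eq]
    refine Prod.ext ?_ ?_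
    · simp [mul_assoc]
    · push_cast
      simp only [add_assoc]

open Classical in
theorem inversionParity_wordProd (ω : List B) (t : W) :
    cs.inversionParity (cs.wordProd ω) t = ((cs.rightInvSeq ω).count t : ZMod 2) := by
  simp [inversionParity, parityAction_wordProd]

theorem parityAction_apply (w t : W) (e : ZMod 2) :
    cs.parityAction w (t, e) = (w * t * w⁻¹, e + cs.inversionParity w t) := by
  obtain ⟨ω, rfl⟩ := cs.wordProd_surjective w
  rw [parityAction_wordProd, inversionParity_wordProd]

theorem inversionParity_mul (x y t : W) : cs.inversionParity (x * y) t =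
    cs.inversionParity y t + cs.inversionParity x (y * t * y⁻¹) := by
  rw [inversionParity, map_mul]
  change (cs.parityAction x (cs.parityAction y (t, 0))).2 = _
  simp [parityAction_apply]

theorem inversionParity_one (t : W) : cs.inversionParity 1 t = 0 := by
  have := cs.inversionParity_mul 1 1 t
  simpa using this

theorem inversionParity_simple_self (i : B) :
    cs.inversionParity (cs.simple i) (cs.simple i) = 1 := by
  rw [inversionParity, parityAction_simple]
  simp [simpleParityMap]

-- For `t = u s u⁻¹` the contributions of `u` and `u⁻¹` cancel, since `u u⁻¹ = 1`; only that of `s`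
-- remains.
variable {cs} in
theorem IsReflection.inversionParity_self {t : W} (ht : cs.IsReflection t) :
    cs.inversionParity t t = 1 := by
  obtain ⟨u, i, rfl⟩ := ht
  have h := cs.inversionParity_mul u u⁻¹ (u * cs.simple i * u⁻¹)
  rw [mul_inv_cancel, inversionParity_one] at h
  rw [inversionParity_mul, inversionParity_mul]
  simp only [mul_assoc, inv_mul_cancel_left, inv_mul_cancel, inv_inv, mul_one, one_mul,
    inversionParity_simple_self, inv_simple, simple_mul_simple_self] at h ⊢
  linear_combination -h

theorem mem_rightInvSeq_of_inversionParity_eq_one {ω : List B} {t : W}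
    (h : cs.inversionParity (cs.wordProd ω) t = 1) : t ∈ cs.rightInvSeq ω := by
  classical
  by_contra hn
  rw [inversionParity_wordProd, List.count_eq_zero_of_not_mem hn] at h
  simp at h

theorem isRightInversion_of_inversionParity_eq_one {w t : W} (h : cs.inversionParity w t = 1) :
    cs.IsRightInversion w t := by
  obtain ⟨ω, hω, rfl⟩ := cs.exists_isReduced w
  exact cs.isRightInversion_of_mem_rightInvSeq hω
    (cs.mem_rightInvSeq_of_inversionParity_eq_one h)

theorem isRightInversion_iff_inversionParity {w t : W} :
    cs.IsRightInversion w t ↔ cs.inversionParity w t = 1 := by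
  refine ⟨fun h ↦ ?_, cs.isRightInversion_of_inversionParity_eq_one⟩
  by_contra hn
  -- If the parity were 0, `t` would invert `w * t`, hence not `w`.
  have h₁ : cs.inversionParity (w * t) t = 1 := by
    rw [inversionParity_mul, h.1.inversionParity_self]
    have : cs.inversionParity w t = 0 := by
      generalize cs.inversionParity w t = a at hn ⊢
      revert a
      decide
    simp [this]
  exact h.1.isRightInversion_mul_left_iff.mp
    (cs.isRightInversion_of_inversionParity_eq_one h₁) h

theorem isLeftInversion_iff_inversionParity {w t : W} :
    cs.IsLeftInversion w t ↔ cs.inversionParity w⁻¹ t = 1 := by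
  rw [← isRightInversion_inv_iff, isRightInversion_iff_inversionParity]

/-- The strong exchange property. -/
theorem mem_leftInvSeq_of_isLeftInversion {ω : List B} {t : W}
    (h : cs.IsLeftInversion (cs.wordProd ω) t) : t ∈ cs.leftInvSeq ω := by
  rw [isLeftInversion_iff_inversionParity, ← wordProd_reverse] at h
  have := cs.mem_rightInvSeq_of_inversionParity_eq_one h
  rwa [rightInvSeq_reverse, List.mem_reverse] at this

theorem isLeftInversion_mul_iff {x y t : W} : cs.IsLeftInversion (x * y) t ↔
    ¬(cs.IsLeftInversion x t ↔ cs.IsLeftInversion y (x⁻¹ * t * x)) := by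
  simp only [isLeftInversion_iff_inversionParity, mul_inv_rev, inversionParity_mul, inv_inv]
  generalize cs.inversionParity x⁻¹ t = a
  generalize cs.inversionParity y⁻¹ (x⁻¹ * t * x) = b
  revert a b
  decide

theorem not_isLeftInversion_one (t : W) : ¬cs.IsLeftInversion 1 t := by
  simp [IsLeftInversion]

theorem eq_simple_of_isLeftInversion_simple {i : B} {t : W}
    (h : cs.IsLeftInversion (cs.simple i) t) : t = cs.simple i := by
  have := cs.mem_leftInvSeq_of_isLeftInversion (ω := [i]) (by simpa using h)
  simpa using this

/-! ### Parabolic subgroups -/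

variable {I J : Set B}

theorem simple_mem_parabolic {i : B} (hi : i ∈ I) : cs.simple i ∈ cs.parabolic I :=
  Subgroup.subset_closure ⟨i, hi, rfl⟩

theorem mem_parabolic_of_isLeftInversion {v : W} (hv : v ∈ cs.parabolic I) :
    ∀ {t : W}, cs.IsLeftInversion v t → t ∈ cs.parabolic I := by
  induction hv using Subgroup.closure_induction with
  | mem x hx =>
    obtain ⟨i, hi, rfl⟩ := hx
    intro t ht
    rw [cs.eq_simple_of_isLeftInversion_simple ht]
    exact cs.simple_mem_parabolic hi
  | one => exact fun ht ↦ (cs.not_isLeftInversion_one _ ht).elim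
  | mul x y hx hy ihx ihy =>
    intro t ht
    rw [isLeftInversion_mul_iff] at ht
    by_cases h : cs.IsLeftInversion x t
    · exact ihx h
    · have h' := ihy (t := x⁻¹ * t * x) (by tauto)
      have := mul_mem (mul_mem (show x ∈ cs.parabolic I from hx) h') (inv_mem hx)
      simpa [mul_assoc] using this
  | inv x hx ih =>
    intro t ht
    have h := cs.isLeftInversion_mul_iff (x := x⁻¹) (y := x) (t := t)
    rw [inv_mul_cancel, inv_inv] at h
    have h' := ih (t := x * t * x⁻¹) (by have := cs.not_isLeftInversion_one t; tauto)
    have := mul_mem (mul_mem (inv_mem (show x ∈ cs.parabolic I from hx)) h') hx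
    simpa [mul_assoc] using this

theorem exists_isReduced_of_mem_parabolic {v : W} (hv : v ∈ cs.parabolic I) :
    ∃ ω : List B, cs.IsReduced ω ∧ (∀ i ∈ ω, i ∈ I) ∧ cs.wordProd ω = v := by
  have step (i : B) (hi : i ∈ I) (y : W) (h : ∃ ω : List B, cs.IsReduced ω ∧ (∀ i ∈ ω, i ∈ I) ∧
      cs.wordProd ω = y) : ∃ ω : List B, cs.IsReduced ω ∧ (∀ i ∈ ω, i ∈ I) ∧
      cs.wordProd ω = cs.simple i * y := by
    obtain ⟨ω, hω, hωI, rfl⟩ := h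
    rcases cs.length_simple_mul (cs.wordProd ω) i with h | h
    · refine ⟨i :: ω, ?_, by simpa using ⟨hi, hωI⟩, wordProd_cons ..⟩
      rw [IsReduced, wordProd_cons, h, hω.eq, List.length_cons]
    · have hmem : cs.simple i ∈ cs.leftInvSeq ω :=
        cs.mem_leftInvSeq_of_isLeftInversion ⟨cs.isReflection_simple i, by lia⟩
      obtain ⟨k, hk, hk'⟩ := List.mem_iff_getElem.mp hmem
      have he := cs.getD_leftInvSeq_mul_wordProd ω k
      rw [List.getD_eq_getElem _ 1 hk, hk'] at he
      rw [length_leftInvSeq] at hk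
      refine ⟨ω.eraseIdx k, ?_, fun j hj ↦ hωI j (List.mem_of_mem_eraseIdx hj), he.symm⟩
      rw [IsReduced, ← he]
      have := List.length_eraseIdx_add_one hk
      have := hω.eq
      lia
  induction hv using Subgroup.closure_induction_left with
  | one => exact ⟨[], by simp [IsReduced], by simp, by simp⟩
  | mul_left x hx y hy ih =>
    obtain ⟨i, hi, rfl⟩ := hx
    exact step i hi y ih
  | inv_mul_cancel x hx y hy ih =>
    obtain ⟨i, hi, rfl⟩ := hx
    rw [inv_simple]
    exact step i hi y ih

theorem exists_leftDescent_of_mem_parabolic {v : W} (hv : v ∈ cs.parabolic I) (h1 : v ≠ 1) :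
    ∃ i ∈ I, cs.IsLeftDescent v i := by
  obtain ⟨ω, hω, hωI, rfl⟩ := cs.exists_isReduced_of_mem_parabolic hv
  cases ω with
  | nil => simp at h1
  | cons i ω =>
    refine ⟨i, hωI i (by simp), ?_⟩
    have h₁ := hω.eq
    have h₂ := cs.length_wordProd_le ω
    rw [IsLeftDescent, h₁, wordProd_cons, simple_mul_simple_cancel_left, List.length_cons]
    lia

theorem exists_rightDescent_of_mem_parabolic {v : W} (hv : v ∈ cs.parabolic I) (h1 : v ≠ 1) :
    ∃ i ∈ I, cs.IsRightDescent v i := by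
  simpa only [isLeftDescent_inv_iff] using
    cs.exists_leftDescent_of_mem_parabolic (inv_mem hv) (inv_ne_one.mpr h1)

theorem exists_minimal_mul_mem_parabolic (I : Set B) (g : W) :
    ∃ u ∈ cs.parabolic I, ∀ v ∈ cs.parabolic I, cs.length (u * g) ≤ cs.length (v * (u * g)) := by
  obtain ⟨u, hu, hmin⟩ := exists_minimal_of_wellFoundedLT
    (α := ℕ) (fun n ↦ ∃ u ∈ cs.parabolic I, cs.length (u * g) = n) ⟨_, 1, one_mem _, rfl⟩
  obtain ⟨u, hu, rfl⟩ := hu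
  refine ⟨u, hu, fun v hv ↦ ?_⟩
  by_contra! h
  have := hmin (y := cs.length (v * (u * g))) ⟨v * u, mul_mem hv hu, by rw [mul_assoc]⟩ h.le
  lia

theorem length_mul_of_minimal {x : W}
    (hx : ∀ v ∈ cs.parabolic I, cs.length x ≤ cs.length (v * x)) {u : W}
    (hu : u ∈ cs.parabolic I) : cs.length (u * x) = cs.length u + cs.length x := by
  induction hn : cs.length u generalizing u with
  | zero => simp [cs.length_eq_zero_iff.mp hn]
  | succ n ih =>
    obtain ⟨i, hi, hd⟩ := cs.exists_leftDescent_of_mem_parabolic hu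
      (by rintro rfl; simp at hn)
    have hu' := mul_mem (cs.simple_mem_parabolic hi) hu
    rw [isLeftDescent_iff] at hd
    have hlen := ih hu' (by lia)
    -- By the cocycle rule, an inversion here would need `s_i` to shorten `s_i u`, or a reflection
    -- in `W_I` to shorten the minimal `x`.
    have h : ¬cs.IsLeftInversion (cs.simple i * u * x) (cs.simple i) := by
      rw [isLeftInversion_mul_iff, not_not]
      refine iff_of_false ?_ ?_
      · rintro ⟨-, h⟩
        rw [simple_mul_simple_cancel_left] at h
        lia
      · rintro ⟨-, h⟩
        refine h.not_ge (hx _ ?_)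
        exact mul_mem (mul_mem (inv_mem hu') (cs.simple_mem_parabolic hi)) hu'
    rw [isLeftInversion_simple_iff_isLeftDescent, not_isLeftDescent_iff, mul_assoc,
      simple_mul_simple_cancel_left, ← mul_assoc] at h
    lia

/-- With `y = z s`, the descent `s` of `w = z⁻¹ (z w)` does not invert `z⁻¹`, so its conjugate
shortens `z w` to `y w`. -/
theorem length_mul_add_of_forall_leftDescent {w : W} (hw : ∀ i ∈ I, cs.IsLeftDescent w i) {y : W}
    (hy : y ∈ cs.parabolic I) : cs.length (y * w) + cs.length y = cs.length w := by
  induction hn : cs.length y generalizing y with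
  | zero => simp [cs.length_eq_zero_iff.mp hn]
  | succ n ih =>
    obtain ⟨i, hi, hd⟩ := cs.exists_rightDescent_of_mem_parabolic hy
      (by rintro rfl; simp at hn)
    set z := y * cs.simple i with hz
    have hyz : y = z * cs.simple i := by simp [hz]
    rw [isRightDescent_iff, ← hz] at hd
    have hlen := ih (mul_mem hy (cs.simple_mem_parabolic hi)) (by lia)
    have h := hw i hi
    rw [← isLeftInversion_simple_iff_isLeftDescent, ← inv_mul_cancel_left z w,
      isLeftInversion_mul_iff] at h
    have h₁ : ¬cs.IsLeftInversion z⁻¹ (cs.simple i) := by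
      rw [isLeftInversion_inv_iff]
      rintro ⟨-, h⟩
      rw [← hyz] at h
      lia
    have h₂ : cs.IsLeftInversion (z * w) (z⁻¹⁻¹ * cs.simple i * z⁻¹) := by tauto
    have h₃ := h₂.2
    rw [show z⁻¹⁻¹ * cs.simple i * z⁻¹ * (z * w) = y * w by rw [hyz]; group] at h₃
    -- The triangle inequality bounds the drop by one.
    have h₄ := cs.length_mul_le y⁻¹ (y * w)
    rw [inv_mul_cancel_left, length_inv] at h₄
    lia

/-- The generators are among the finitely many inversions of `w`, and lengths in `W_I` are at most
that of `w`. -/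
theorem finite_parabolic_of_forall_leftDescent {w : W} (hw : ∀ i ∈ I, cs.IsLeftDescent w i) :
    (cs.parabolic I : Set W).Finite := by
  have hI : (cs.simple '' I).Finite := by
    obtain ⟨ω, rfl⟩ := cs.wordProd_surjective w
    refine (List.finite_toSet (cs.leftInvSeq ω)).subset ?_
    rintro _ ⟨i, hi, rfl⟩
    exact cs.mem_leftInvSeq_of_isLeftInversion
      ((cs.isLeftInversion_simple_iff_isLeftDescent _ _).mpr (hw i hi))
  have hfin (n : ℕ) : {v | v ∈ cs.parabolic I ∧ cs.length v ≤ n}.Finite := by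
    induction n with
    | zero =>
      refine (Set.finite_singleton 1).subset ?_
      rintro v ⟨-, hv⟩
      exact cs.length_eq_zero_iff.mp (Nat.le_zero.mp hv)
    | succ n ih =>
      refine ((Set.finite_singleton 1).union (hI.image2 (· * ·) ih)).subset ?_
      rintro v ⟨hvI, hv⟩
      by_cases h1 : v = 1
      · exact .inl h1
      obtain ⟨i, hi, hd⟩ := cs.exists_leftDescent_of_mem_parabolic hvI h1
      rw [isLeftDescent_iff] at hd
      exact .inr ⟨cs.simple i, ⟨i, hi, rfl⟩, cs.simple i * v,
        ⟨mul_mem (cs.simple_mem_parabolic hi) hvI, by lia⟩, by simp⟩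
  refine (hfin (cs.length w)).subset fun v hv ↦ ⟨hv, ?_⟩
  have := cs.length_mul_add_of_forall_leftDescent hw hv
  lia

/-! ### Longest elements -/

variable {cs}

theorem IsLongestElement.isLeftDescent {w : W} (hw : cs.IsLongestElement I w) {i : B}
    (hi : i ∈ I) : cs.IsLeftDescent w i :=
  (hw.length_le _ (mul_mem (cs.simple_mem_parabolic hi) hw.mem)).lt_of_ne
    (cs.length_simple_mul_ne w i)

theorem IsLongestElement.eq_of_length_le {w v : W} (hw : cs.IsLongestElement I w)
    (hv : v ∈ cs.parabolic I) (h : cs.length w ≤ cs.length v) : v = w := by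
  have h' := cs.length_mul_add_of_forall_leftDescent (fun i ↦ hw.isLeftDescent) (inv_mem hv)
  rw [length_inv] at h'
  have h₀ : cs.length (v⁻¹ * w) = 0 := by lia
  exact inv_mul_eq_one.mp (cs.length_eq_zero_iff.mp h₀)

theorem IsLongestElement.parabolic_le {w : W} (hI : cs.IsLongestElement I w)
    (hJ : w ∈ cs.parabolic J) : cs.parabolic I ≤ cs.parabolic J := by
  rw [parabolic, Subgroup.closure_le]
  rintro _ ⟨i, hi, rfl⟩
  exact cs.mem_parabolic_of_isLeftInversion hJ
    ((cs.isLeftInversion_simple_iff_isLeftDescent _ _).mpr (hI.isLeftDescent hi))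

theorem IsLongestElement.parabolic_eq {w : W} (hI : cs.IsLongestElement I w)
    (hJ : cs.IsLongestElement J w) : cs.parabolic I = cs.parabolic J :=
  le_antisymm (hI.parabolic_le hJ.mem) (hJ.parabolic_le hI.mem)

/-! ### Normalizer of `W_I` and centralizer of `w_0(I)` -/

variable (cs) in
theorem length_conj_wordProd_le {x : W}
    (hx : ∀ i ∈ I, cs.length (x * cs.simple i * x⁻¹) ≤ 1) {ω : List B} (hω : ∀ i ∈ ω, i ∈ I) :
    cs.length (x * cs.wordProd ω * x⁻¹) ≤ ω.length := by
  induction ω with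
  | nil => simp
  | cons i ω ih =>
    have h₁ := hx i (hω i (by simp))
    have h₂ := ih fun j hj ↦ hω j (by simp [hj])
    have h₃ := cs.length_mul_le (x * cs.simple i * x⁻¹) (x * cs.wordProd ω * x⁻¹)
    rw [show x * cs.simple i * x⁻¹ * (x * cs.wordProd ω * x⁻¹) =
      x * cs.wordProd (i :: ω) * x⁻¹ by rw [wordProd_cons]; group] at h₃
    rw [List.length_cons]
    lia

/-- A minimal representative `x` of `W_I g` sends simple reflections of `W_I` to elements of length
at most 1, so it fixes the longest element; the remaining factor in `W_I` commutes with `w` by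
centrality. -/
theorem IsCentralLongestElement.commute_of_mem_normalizer {w g : W}
    (hw : cs.IsCentralLongestElement I w)
    (hg : g ∈ Subgroup.normalizer (cs.parabolic I : Set W)) : g * w = w * g := by
  obtain ⟨u, hu, hmin⟩ := cs.exists_minimal_mul_mem_parabolic I g
  set x := u * g with hx
  have hxN : x ∈ Subgroup.normalizer (cs.parabolic I : Set W) :=
    mul_mem (Subgroup.le_normalizer hu) hg
  have hone (i : B) (hi : i ∈ I) : cs.length (x * cs.simple i * x⁻¹) ≤ 1 := by
    have hv := (Subgroup.mem_normalizer_iff.mp hxN _).mp (cs.simple_mem_parabolic hi)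
    have h₁ := cs.length_mul_of_minimal hmin hv
    have h₂ := cs.length_mul_le x (cs.simple i)
    rw [inv_mul_cancel_right] at h₁
    rw [length_simple] at h₂
    lia
  have hw' : x⁻¹ * w * x ∈ cs.parabolic I :=
    (Subgroup.mem_normalizer_iff''.mp hxN _).mp hw.isLongestElement.mem
  have hlen : cs.length w ≤ cs.length (x⁻¹ * w * x) := by
    obtain ⟨ω, hω, hωI, he⟩ := cs.exists_isReduced_of_mem_parabolic hw'
    have h := cs.length_conj_wordProd_le hone hωI
    rw [← hω.eq, he] at h
    simpa [mul_assoc] using h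
  have hcomm := hw.isLongestElement.eq_of_length_le hw' hlen
  have hxw : w * x = x * w := by
    nth_rw 2 [← hcomm]
    simp [mul_assoc]
  have huw := hw.central _ hu
  apply mul_left_cancel (a := u)
  rw [← mul_assoc, ← hx, ← hxw, hx, ← mul_assoc, ← mul_assoc, huw]

/-- For `x` minimal in `W_I g` and `s` in `I`, the reflection `x s x⁻¹` commutes with `w` and
shortens `w x = x w` but not `x`. It is thus an inversion of `w`, hence in `W_I`. -/
theorem IsCentralLongestElement.conj_mem_parabolic {w g : W}
    (hw : cs.IsCentralLongestElement I w) (hg : g * w = w * g) {v : W}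
    (hv : v ∈ cs.parabolic I) : g * v * g⁻¹ ∈ cs.parabolic I := by
  obtain ⟨u, hu, hmin⟩ := cs.exists_minimal_mul_mem_parabolic I g
  set x := u * g with hx
  have hxw : x * w = w * x := by
    rw [hx, mul_assoc, hg, ← mul_assoc, hw.central _ hu, mul_assoc]
  have hlen : cs.length (x * w) = cs.length w + cs.length x := by
    rw [hxw, cs.length_mul_of_minimal hmin hw.isLongestElement.mem]
  have hgen (i : B) (hi : i ∈ I) : x * cs.simple i * x⁻¹ ∈ cs.parabolic I := by
    have hd := hw.isLongestElement.isLeftDescent hi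
    rw [isLeftDescent_iff] at hd
    have hinv : cs.IsLeftInversion (w * x) (x * cs.simple i * x⁻¹) := by
      refine ⟨(cs.isReflection_simple i).conj x, ?_⟩
      have h := cs.length_mul_le x (cs.simple i * w)
      rw [← hxw, show x * cs.simple i * x⁻¹ * (x * w) = x * (cs.simple i * w) by group]
      lia
    have hnot : ¬cs.IsLeftInversion x (w⁻¹ * (x * cs.simple i * x⁻¹) * w) := by
      rintro ⟨-, h⟩
      have hcw : w⁻¹ * (x * cs.simple i * x⁻¹) * w = x * cs.simple i * x⁻¹ := by
        have hs : Commute (cs.simple i) w := hw.central _ (cs.simple_mem_parabolic hi)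
        have hx' : Commute x w := hxw
        rw [mul_assoc, inv_mul_eq_iff_eq_mul]
        exact ((hx'.mul_left hs).mul_left hx'.inv_left).eq
      rw [hcw, inv_mul_cancel_right] at h
      have h' := cs.length_mul_le (x * cs.simple i) (cs.simple i * w)
      rw [show x * cs.simple i * (cs.simple i * w) = x * w by simp [mul_assoc]] at h'
      lia
    rw [isLeftInversion_mul_iff] at hinv
    exact cs.mem_parabolic_of_isLeftInversion hw.isLongestElement.mem (by tauto)
  have hle : cs.parabolic I ≤ (cs.parabolic I).comap (MulAut.conj x).toMonoidHom := by
    nth_rw 1 [parabolic]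
    rw [Subgroup.closure_le]
    rintro _ ⟨i, hi, rfl⟩
    exact hgen i hi
  have h : x * v * x⁻¹ ∈ cs.parabolic I := hle hv
  have h' := mul_mem (mul_mem (inv_mem hu) h) hu
  rwa [show u⁻¹ * (x * v * x⁻¹) * u = g * v * g⁻¹ by rw [hx]; group] at h'

theorem IsCentralLongestElement.mem_normalizer_iff {w g : W}
    (hw : cs.IsCentralLongestElement I w) :
    g ∈ Subgroup.normalizer (cs.parabolic I : Set W) ↔ g * w = w * g := by
  refine ⟨hw.commute_of_mem_normalizer, fun hg ↦ Subgroup.mem_normalizer_iff.mpr fun v ↦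
    ⟨hw.conj_mem_parabolic hg, fun hv ↦ ?_⟩⟩
  have hg' : g⁻¹ * w = w * g⁻¹ := by
    rw [inv_mul_eq_iff_eq_mul, ← mul_assoc, hg, mul_inv_cancel_right]
  have := hw.conj_mem_parabolic hg' hv
  simpa [mul_assoc] using this

variable (cs) in
/-- An involution which is of minimal length among its conjugates by simple reflections is the
central longest element of the parabolic subgroup generated by its descents. -/
theorem isCentralLongestElement_of_forall_length_le {w : W} (h1 : w ≠ 1) (hw : w⁻¹ = w)
    (hmin : ∀ i, cs.length w ≤ cs.length (cs.simple i * w * cs.simple i)) :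
    cs.IsCentralLongestElement {i | cs.IsLeftDescent w i} w := by
  set I : Set B := {i | cs.IsLeftDescent w i} with hI
  have hd : ∀ i ∈ I, cs.IsLeftDescent w i := fun i hi ↦ hi
  have hright (i : B) : cs.IsRightDescent w i ↔ i ∈ I := by
    rw [← isLeftDescent_inv_iff, hw]
    rfl
  have hcomm (i : B) (hi : i ∈ I) : cs.simple i * w = w * cs.simple i := by
    -- As `s` inverts `w` but not `w s`, the cocycle rule forces `w⁻¹ s w` to invert `s`, so it
    -- equals `s`.
    have h₁ : ¬cs.IsLeftInversion (w * cs.simple i) (cs.simple i) := by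
      rintro ⟨-, h⟩
      have h₂ : cs.length (w * cs.simple i) < cs.length w := (hright i).mpr hi
      have h₃ := hmin i
      rw [mul_assoc] at h₃
      lia
    have h₂ := (cs.isLeftInversion_simple_iff_isLeftDescent w i).mpr hi
    rw [isLeftInversion_mul_iff] at h₁
    have h₃ : cs.IsLeftInversion (cs.simple i) (w⁻¹ * cs.simple i * w) := by tauto
    have h₄ := cs.eq_simple_of_isLeftInversion_simple h₃
    rwa [mul_assoc, inv_mul_eq_iff_eq_mul] at h₄
  have hmem : w ∈ cs.parabolic I := by
    -- If `u w ≠ 1`, a right descent `r` of it is also one of `w`, so `r ∈ I` commutes with `w`;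
    -- moved to the left, it would shorten the minimal `u w` by an element of `W_I`.
    obtain ⟨u, hu, hx⟩ := cs.exists_minimal_mul_mem_parabolic I w
    by_cases hx1 : u * w = 1
    · rw [eq_inv_of_mul_eq_one_right hx1]
      exact inv_mem hu
    obtain ⟨r, hr⟩ := cs.exists_rightDescent_of_ne_one hx1
    have hlen := cs.length_mul_of_minimal hx (inv_mem hu)
    rw [inv_mul_cancel_left] at hlen
    have hrI : r ∈ I := by
      rw [← hright, IsRightDescent]
      have h := cs.length_mul_le u⁻¹ (u * w * cs.simple r)
      rw [← mul_assoc, inv_mul_cancel_left] at h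
      rw [IsRightDescent] at hr
      lia
    have hconj : u * w * cs.simple r = u * cs.simple r * u⁻¹ * (u * w) := by
      rw [mul_assoc, ← hcomm r hrI]
      group
    rw [IsRightDescent, hconj] at hr
    exact (hr.not_ge (hx _ (mul_mem (mul_mem hu (cs.simple_mem_parabolic hrI))
      (inv_mem hu)))).elim
  refine ⟨⟨cs.finite_parabolic_of_forall_leftDescent hd, hmem, fun u hu ↦ ?_⟩, h1, fun u hu ↦ ?_⟩
  · have := cs.length_mul_add_of_forall_leftDescent hd hu
    lia
  · have hle : cs.parabolic I ≤ Subgroup.centralizer {w} := by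
      rw [parabolic, Subgroup.closure_le]
      rintro _ ⟨i, hi, rfl⟩
      exact Subgroup.mem_centralizer_singleton_iff.mpr (hcomm i hi)
    exact Subgroup.mem_centralizer_singleton_iff.mp (hle hu)

variable (cs) in
/-- Richardson's theorem: every involution is conjugate to the central longest element of a finite
parabolic subgroup. -/
theorem exists_conj_isCentralLongestElement {w : W} (h1 : w ≠ 1) (hw : w⁻¹ = w) :
    ∃ (g : W) (I : Set B), cs.IsCentralLongestElement I (g * w * g⁻¹) := by
  induction hn : cs.length w using Nat.strong_induction_on generalizing w with
  | _ n ih =>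
    by_cases hmin : ∀ i, cs.length w ≤ cs.length (cs.simple i * w * cs.simple i)
    · exact ⟨1, _, by simpa using cs.isCentralLongestElement_of_forall_length_le h1 hw hmin⟩
    push Not at hmin
    obtain ⟨i, hi⟩ := hmin
    have hconj : cs.simple i * w * cs.simple i = cs.simple i * w * (cs.simple i)⁻¹ := by simp
    obtain ⟨g, I, hg⟩ := ih _ (hn ▸ hi) (w := cs.simple i * w * cs.simple i)
      (by rwa [hconj, Ne, conj_eq_one_iff]) (by simp [hw, mul_assoc]) rfl
    refine ⟨g * cs.simple i, I, ?_⟩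
    simpa [mul_assoc] using hg

end CoxeterSystem

/-! ### Generation and centralizer of `H` -/

theorem proposition4p1 {B W : Type*} [Group W] {M : CoxeterMatrix B} (cs : CoxeterSystem M W)
    (H : Subgroup W) (hnormal : H.Normal) (hinv : GeneratedByInvolutions H) :
    Subgroup.normalClosure (cs.centralLongestElements H) = H ∧
    Subgroup.centralizer (H : Set W) =
      ⨅ (I : Set B) (_ : ∃ w ∈ cs.centralLongestElements H, cs.IsLongestElement I w),
        (Subgroup.normalizer (cs.parabolic I : Set W)).normalCore := by
  have hclosure : Subgroup.normalClosure (cs.centralLongestElements H) = H := by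
    refine le_antisymm (Subgroup.normalClosure_le_normal fun w hw ↦ hw.1) ?_
    obtain ⟨T, hT, rfl⟩ := hinv
    rw [Subgroup.closure_le]
    intro t ht
    have h2 := hT t ht
    have ht1 : t ≠ 1 := by
      rintro rfl
      simp at h2
    have htinv : t⁻¹ = t := by
      have := pow_orderOf_eq_one t
      rw [h2, pow_two] at this
      exact inv_eq_of_mul_eq_one_left this
    obtain ⟨g, I, hg⟩ := cs.exists_conj_isCentralLongestElement ht1 htinv
    have hmem : g * t * g⁻¹ ∈ cs.centralLongestElements (Subgroup.closure T) :=
      ⟨hnormal.conj_mem _ (Subgroup.subset_closure ht) g, I, hg⟩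
    have := Subgroup.normalClosure_normal.conj_mem _
      (Subgroup.subset_normalClosure hmem) g⁻¹
    simpa [mul_assoc] using this
  refine ⟨hclosure, le_antisymm ?_ ?_⟩
  · simp only [le_iInf_iff]
    rintro I ⟨w, ⟨hwH, J, hJ⟩, hI⟩ z hz g
    -- Centrality of `w` is known through `J`, not `I`; both give the same parabolic subgroup.
    rw [hI.parabolic_eq hJ.isLongestElement, hJ.mem_normalizer_iff]
    have h := Subgroup.mem_centralizer_iff.mp hz _ (hnormal.conj_mem w hwH g⁻¹)
    rw [inv_inv] at h
    calc g * z * g⁻¹ * w = g * (z * (g⁻¹ * w * g)) * g⁻¹ := by group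
      _ = g * (g⁻¹ * w * g * z) * g⁻¹ := by rw [h]
      _ = w * (g * z * g⁻¹) := by group
  · intro z hz
    have hle : H ≤ Subgroup.centralizer {z} := by
      rw [← hclosure, Subgroup.normalClosure, Subgroup.closure_le]
      intro y hy
      obtain ⟨w, hw, hwy⟩ := Group.mem_conjugatesOfSet_iff.mp hy
      obtain ⟨g, rfl⟩ := isConj_iff.mp hwy
      obtain ⟨hwH, I, hI⟩ := hw
      simp only [Subgroup.mem_iInf] at hz
      have h := hz I ⟨w, ⟨hwH, I, hI⟩, hI.isLongestElement⟩ g⁻¹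
      rw [hI.mem_normalizer_iff, inv_inv] at h
      refine Subgroup.mem_centralizer_singleton_iff.mpr ?_
      calc g * w * g⁻¹ * z = g * (w * (g⁻¹ * z * g)) * g⁻¹ := by group
        _ = g * (g⁻¹ * z * g * w) * g⁻¹ := by rw [h]
        _ = z * (g * w * g⁻¹) := by group
    exact Subgroup.mem_centralizer_iff.mpr fun y hy ↦
      Subgroup.mem_centralizer_singleton_iff.mp (hle hy)
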